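/- For a sequence $(s_1,\dots,s_r)$ of positive integers, some of which may carry a bar, let \[ \zeta(s_1,\dots,s_r)=\lim_{n\to\infty}\ \sum_{n\ge k_1>k_2>\cdots>k_r\ge 1}\ \prod_{j=1}^{r}\frac{\varepsilon_j^{\,k_j}}{k_j^{\,s_j}}, \] where $\varepsilon_j=-1$ if $s_j$ carries a bar and $\varepsilon_j=1$ otherwise. Let $\{1\}_{r}$ denote the entry $1$ repeated $r$ times, let $\zeta(j)$ be the values of the Riemann zeta function, and let $\mathrm{Li}_p(x)=\sum_{n\ge1}x^n/n^p$. Theorem. For all integers $m,k\ge 1$, the limit defining the alternating multiple zeta value \[ \zeta(\bar 1,\{1\}_{m-1},\bar 1,\bar 1,\{1\}_{k-1}) \] exists, and its value is a linear combination with rational coefficients of finite nonempty products of numbers from the set \[ \{\zeta(j): j\ge 2\}\ \cup\ \{\mathrm{Li}_p(\tfrac12): p\ge 1\}\ \cup\ \{\ln 2\}. \] -/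

import Mathlib

open Filter Topology

noncomputable section

/-- The (alternating) multiple harmonic number `ζ_n(s₁, …, s_r)`, the sum over
`n ≥ k₁ > k₂ > ⋯ > k_r ≥ 1` of `∏ⱼ εⱼ ^ kⱼ / kⱼ ^ |sⱼ|`, where `εⱼ = -1` if `sⱼ < 0` and `εⱼ = 1`
otherwise. A barred entry `s̄` is encoded as the negative integer `-s`. The sum is organised by its
largest summation index `k₁ = k`, the remaining indices being at most `k - 1`;
`ζ_n(∅) = 1`. -/
def altMHN : List ℤ → ℕ → ℝ
  | [], _ => 1
  | s :: t, n =>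
      ∑ k ∈ Finset.Icc 1 n,
        (if s < 0 then (-1 : ℝ) ^ k else 1) / (k : ℝ) ^ s.natAbs * altMHN t (k - 1)

/-- The alternating multiple zeta value `ζ(s₁, …, s_r)` exists and equals `z`:
it is the limit of the multiple harmonic numbers `ζ_n(s₁, …, s_r)` as `n → ∞`. -/
def HasAltMZV (s : List ℤ) (z : ℝ) : Prop :=
  Tendsto (altMHN s) atTop (𝓝 z)

/-- The polylogarithm `Li_p(x) = ∑_{n ≥ 1} x ^ n / n ^ p`, for `|x| < 1`. -/
def polylog (p : ℕ) (x : ℝ) : ℝ :=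
  ∑' n : ℕ, x ^ (n + 1) / ((n : ℝ) + 1) ^ p

/-- The real numbers `ζ(j)` with `j ≥ 2`, `Li_p(1/2)` with `p ≥ 1`, and `ln 2`. -/
def basicConstants : Set ℝ :=
  {x | ∃ j : ℕ, 2 ≤ j ∧ (x : ℂ) = riemannZeta (j : ℂ)} ∪
    {x | ∃ p : ℕ, 1 ≤ p ∧ x = polylog p (1 / 2)} ∪ {Real.log 2}

/-- The rational linear combinations of (nonempty, finite) products of zeta values,
polylogarithms at `1/2` and `ln 2`. -/
def rationalCombinations : Submodule ℚ ℝ :=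
  Submodule.span ℚ (Subsemigroup.closure basicConstants : Set ℝ)

end

/-! The generating function `G_s(x) = ∑ (ζ_n(s) - ζ_{n-1}(s)) xⁿ` satisfies `G_{a::t}'(x) = a
G_t(ax) / (1 - ax)` for `a = ±1` (`hasDerivAt_altMHNGenFun_cons`), and by Abel's theorem it tends to
the zeta value as `x → 1⁻`. A leading bar makes the limit exist: its alternating summands form a
null sequence of bounded variation.

The tail `1̄, {1}_{k-1}` gives `(-log(1+x))^k / k!`. The next bar integrates this against
`dt/(1-t)`, and the remaining `m` entries each integrate against `-dt/(1+t)`. With `w(t) =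
log((1+t)/2)`, the value is `(-1)^m` times the limit at `x = 1` of `∫₀ˣ (w(x)-w(t))^m/m! ·
(-log(1+t))^k/k! dt/(1-t)`.

Since `log(1+t) = w(t) + log 2` and `w(1) = 0`, substituting `y = (1+t)/2` leaves integrals of
`log^p y / (1-y)` over `[1/2, 1]`. Integration by parts (`logPolylogPrimitive`) evaluates them by
polylogarithms at `1/2` and at `1`, the latter being zeta values. -/

/-! ### Growth of multiple harmonic numbers and existence of the limit -/

theorem altMHN_cons_succ (s : ℤ) (t : List ℤ) (n : ℕ) :
    altMHN (s :: t) (n + 1) = altMHN (s :: t) n +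
      (if s < 0 then (-1 : ℝ) ^ (n + 1) else 1) / ((n : ℝ) + 1) ^ s.natAbs * altMHN t n := by
  simp [altMHN, Finset.sum_Icc_succ_top]

theorem altMHN_cons_zero (s : ℤ) (t : List ℤ) : altMHN (s :: t) 0 = 0 := by
  simp [altMHN]

theorem abs_altMHN_summand_le {s : ℤ} (hs : s ≠ 0) (n : ℕ) (y : ℝ) :
    |(if s < 0 then (-1 : ℝ) ^ (n + 1) else 1) / ((n : ℝ) + 1) ^ s.natAbs * y| ≤
      |y| / ((n : ℝ) + 1) := by
  have h1 : |(if s < 0 then (-1 : ℝ) ^ (n + 1) else 1)| = 1 := by split_ifs <;> simp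
  have h2 : (n : ℝ) + 1 ≤ ((n : ℝ) + 1) ^ s.natAbs :=
    le_self_pow₀ (by linarith [n.cast_nonneg (α := ℝ)]) (by simpa using hs)
  have h3 : (0 : ℝ) < n + 1 := by positivity
  rw [abs_mul, abs_div, h1, abs_of_pos (h3.trans_le h2), one_div, inv_mul_eq_div]
  exact div_le_div_of_nonneg_left (abs_nonneg y) h3 h2

theorem abs_altMHN_div_le {C : ℝ} {t : List ℤ} {n : ℕ} (h : |altMHN t n| ≤ C * √((n : ℝ) + 1)) :
    |altMHN t n| / ((n : ℝ) + 1) ≤ C / √((n : ℝ) + 1) := by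
  have hn : (0 : ℝ) < n + 1 := by positivity
  have h0 : 0 < √((n : ℝ) + 1) := Real.sqrt_pos.2 hn
  rw [div_le_div_iff₀ hn h0]
  nth_rewrite 2 [← Real.mul_self_sqrt hn.le]
  rw [← mul_assoc]
  exact mul_le_mul_of_nonneg_right h h0.le

/-- Each extra entry sums terms of size at most `C/√(n+1)`, which costs a factor 2. The bound is
crude but uniform in the signs. -/
theorem abs_altMHN_le (s : List ℤ) (hs : ∀ a ∈ s, a ≠ 0) (n : ℕ) :
    |altMHN s n| ≤ 2 ^ s.length * √((n : ℝ) + 1) := by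
  induction s generalizing n with
  | nil => simp [altMHN]
  | cons a t ih =>
    have iht := ih fun b hb => hs b (List.mem_cons_of_mem _ hb)
    -- With `√n` in place of `√(n+1)` the inner induction telescopes and starts at `0 ≤ 0`.
    suffices h : |altMHN (a :: t) n| ≤ 2 ^ (a :: t).length * √(n : ℝ) from
      h.trans (by gcongr; linarith)
    induction n with
    | zero => simp [altMHN_cons_zero]
    | succ n ihn =>
      rw [altMHN_cons_succ]
      have hb := (abs_altMHN_summand_le (hs a List.mem_cons_self) n (altMHN t n)).trans
        (abs_altMHN_div_le (iht n))
      have h0 : 0 < √((n : ℝ) + 1) := Real.sqrt_pos.2 (by positivity)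
      have h1 : 1 / √((n : ℝ) + 1) ≤ 2 * (√((n : ℝ) + 1) - √n) := by
        rw [div_le_iff₀ h0]
        nlinarith [Real.mul_self_sqrt (show (0 : ℝ) ≤ n + 1 by positivity),
          Real.mul_self_sqrt (n.cast_nonneg (α := ℝ)), sq_nonneg (√((n : ℝ) + 1) - √n)]
      have h2 := mul_le_mul_of_nonneg_left h1 (show (0 : ℝ) ≤ 2 ^ t.length by positivity)
      refine (abs_add_le _ _).trans ((add_le_add ihn hb).trans ?_)
      rw [div_eq_mul_one_div, List.length_cons, pow_succ]
      push_cast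
      linarith

/-- An alternating sum of a null sequence of bounded variation converges. -/
theorem exists_tendsto_sum_alternating {b : ℕ → ℝ} (hb : Tendsto b atTop (𝓝 0))
    (hv : Summable fun n => |b (n + 1) - b n|) :
    ∃ z, Tendsto (fun n => ∑ i ∈ Finset.range n, (-1) ^ i * b i) atTop (𝓝 z) := by
  have hs : Summable fun n => (-1 : ℝ) ^ n * (b (n + 1) - b n) :=
    Summable.of_norm (by simpa [abs_mul] using hv)
  -- Summation by parts.
  have hsum (n : ℕ) : ∑ i ∈ Finset.range n, (-1) ^ i * b i =
      (b 0 - (-1) ^ n * b n - ∑ i ∈ Finset.range n, (-1 : ℝ) ^ i * (b (i + 1) - b i)) / 2 := by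
    induction n with
    | zero => simp
    | succ n ih => rw [Finset.sum_range_succ, Finset.sum_range_succ, ih]; ring
  have h0 : Tendsto (fun n => (-1 : ℝ) ^ n * b n) atTop (𝓝 0) := by
    rw [tendsto_zero_iff_norm_tendsto_zero] at hb ⊢
    simpa using hb
  refine ⟨_, ((h0.const_sub (b 0)).sub hs.hasSum.tendsto_sum_nat).div_const 2 |>.congr
    fun n => (hsum n).symm⟩

/-- The square-root bound makes `ζ_n(t)/(n+1)` a null sequence whose increments are
`O((n+1)^(-3/2))`, hence of bounded variation. -/
theorem exists_hasAltMZV_neg_one_cons (t : List ℤ) (ht : ∀ a ∈ t, a ≠ 0) :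
    ∃ z, HasAltMZV (-1 :: t) z := by
  set C : ℝ := 2 ^ t.length with hC
  have hC1 : 1 ≤ C := one_le_pow₀ one_le_two
  have hA := abs_altMHN_le t ht
  have hdiv (n : ℕ) := abs_altMHN_div_le (hA n)
  have hdiff (n : ℕ) : |altMHN t (n + 1) - altMHN t n| ≤ C / √((n : ℝ) + 1) := by
    cases t with
    | nil => simp [altMHN]; positivity
    | cons a t =>
      have h := abs_altMHN_le t (fun b hb => ht b (List.mem_cons_of_mem _ hb)) n
      rw [altMHN_cons_succ, add_sub_cancel_left]
      refine (abs_altMHN_summand_le (ht a List.mem_cons_self) n _).trans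
        (abs_altMHN_div_le (h.trans ?_))
      rw [hC, List.length_cons]
      gcongr <;> simp
  obtain ⟨z, hz⟩ := exists_tendsto_sum_alternating (b := fun n => altMHN t n / ((n : ℝ) + 1)) (by
      refine squeeze_zero_norm (a := fun n : ℕ => C / √((n : ℝ) + 1)) (fun n => ?_) ?_
      · rw [Real.norm_eq_abs, abs_div, abs_of_pos (show (0 : ℝ) < n + 1 by positivity)]
        exact hdiv n
      · refine Tendsto.div_atTop tendsto_const_nhds (Real.tendsto_sqrt_atTop.comp ?_)
        exact tendsto_atTop_add_const_right _ _ tendsto_natCast_atTop_atTop) (by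
      have hsum : Summable fun n : ℕ => 1 / |(n : ℝ) + 1| ^ (3 / 2 : ℝ) :=
        Real.summable_one_div_nat_add_rpow 1 (3 / 2) |>.2 (by norm_num)
      refine Summable.of_nonneg_of_le (fun _ => abs_nonneg _) (fun n => ?_)
        (hsum.mul_left (2 * C))
      have hn : (0 : ℝ) < n + 1 := by positivity
      have hs : 0 < √((n : ℝ) + 1) := Real.sqrt_pos.2 hn
      have he : 1 / |(n : ℝ) + 1| ^ (3 / 2 : ℝ) = 1 / √((n : ℝ) + 1) / ((n : ℝ) + 1) := by
        rw [abs_of_pos hn, show (3 / 2 : ℝ) = 1 / 2 + 1 by norm_num, Real.rpow_add hn,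
          Real.rpow_one, ← Real.sqrt_eq_rpow, div_div]
      have hsplit : altMHN t (n + 1) / (((n + 1 : ℕ) : ℝ) + 1) - altMHN t n / ((n : ℝ) + 1) =
          ((altMHN t (n + 1) - altMHN t n) - altMHN t n / ((n : ℝ) + 1)) / ((n : ℝ) + 1 + 1) := by
        push_cast
        field_simp
        ring
      rw [he, hsplit, abs_div, abs_of_pos (show (0 : ℝ) < (n : ℝ) + 1 + 1 by positivity)]
      have h1 : |(altMHN t (n + 1) - altMHN t n) - altMHN t n / ((n : ℝ) + 1)| ≤
          2 * C * (1 / √((n : ℝ) + 1)) := by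
        refine (abs_sub _ _).trans ((add_le_add (hdiff n) ?_).trans (b :=
          C / √((n : ℝ) + 1) + C / √((n : ℝ) + 1)) ?_)
        · rw [abs_div, abs_of_pos hn]; exact hdiv n
        · apply le_of_eq; ring
      rw [← mul_div_assoc]
      exact div_le_div₀ (by positivity) h1 hn (by linarith))
  refine ⟨-z, hz.neg.congr fun n => ?_⟩
  induction n with
  | zero => simp [altMHN_cons_zero]
  | succ n ih =>
    rw [altMHN_cons_succ, ← ih, Finset.sum_range_succ]
    simp [pow_succ]
    ring

/-! ### Generating functions and their differential equations -/

theorem summable_mul_pow_of_abs_le {c : ℕ → ℝ} {C x : ℝ} (hc : ∀ n, |c n| ≤ C * ((n : ℝ) + 1))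
    (hx : |x| < 1) : Summable fun n => c n * x ^ n := by
  have h := ((summable_pow_mul_geometric_of_norm_lt_one 1 (r := |x|) (by simpa using hx)).add
    (summable_geometric_of_abs_lt_one (r := |x|) (by simpa using hx))).mul_left C
  refine Summable.of_norm_bounded h fun n => ?_
  rw [Real.norm_eq_abs, abs_mul, abs_pow]
  refine (mul_le_mul_of_nonneg_right (hc n) (by positivity)).trans_eq ?_
  ring

/-- Termwise integration of a power series. -/
theorem hasDerivAt_tsum_div_mul_pow {c : ℕ → ℝ} {C x : ℝ} (hc : ∀ n, |c n| ≤ C * ((n : ℝ) + 1))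
    (hx : |x| < 1) :
    HasDerivAt (fun y => ∑' n : ℕ, c n / ((n : ℝ) + 1) * y ^ (n + 1)) (∑' n, c n * x ^ n) x := by
  obtain ⟨r, hxr, hr⟩ := exists_between hx
  have hr0 : 0 ≤ r := (abs_nonneg x).trans hxr.le
  refine hasDerivAt_tsum_of_isPreconnected (F := ℝ) (𝕜 := ℝ)
    (g := fun n y => c n / ((n : ℝ) + 1) * y ^ (n + 1)) (g' := fun n y => c n * y ^ n)
    (u := fun n => |c n| * r ^ n) (t := Set.Ioo (-r) r)
    (y₀ := 0) (summable_mul_pow_of_abs_le (C := C) (by simpa using hc)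
      (by rwa [abs_of_nonneg hr0])) isOpen_Ioo isPreconnected_Ioo ?_ ?_ ?_ ?_ (abs_lt.1 hxr)
  · intro n y _
    have h := (hasDerivAt_pow (n + 1) y).const_mul (c n / ((n : ℝ) + 1))
    refine h.congr_deriv ?_
    push_cast
    field_simp
  · intro n y hy
    rw [Real.norm_eq_abs, abs_mul, abs_pow]
    gcongr
    exact (abs_lt.2 hy).le
  · exact ⟨by linarith [abs_nonneg x], by linarith [abs_nonneg x]⟩
  · simp

theorem one_sub_mul_tsum_mul_pow {A : ℕ → ℝ} {x : ℝ} (hA : Summable fun n => A n * x ^ n) :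
    (1 - x) * ∑' n, A n * x ^ n = A 0 + ∑' n, (A (n + 1) - A n) * x ^ (n + 1) := by
  have h1 : Summable fun n => A (n + 1) * x ^ (n + 1) :=
    (summable_nat_add_iff (f := fun n => A n * x ^ n) 1).2 hA
  have h2 : ∀ n, A n * x ^ (n + 1) = x * (A n * x ^ n) := fun n => by ring
  simp_rw [sub_mul]
  rw [h1.tsum_sub (by simpa only [h2] using hA.mul_left x)]
  simp_rw [h2]
  rw [tsum_mul_left, one_mul, ← add_sub_assoc, hA.tsum_eq_zero_add]
  simp

/-- The generating function `∑ₙ (ζ_n(s) - ζ_{n-1}(s)) xⁿ`. -/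
noncomputable def altMHNGenFun (s : List ℤ) (x : ℝ) : ℝ :=
  (1 - x) * ∑' n, altMHN s n * x ^ n

theorem abs_altMHN_le_linear (s : List ℤ) (hs : ∀ a ∈ s, a ≠ 0) (n : ℕ) :
    |altMHN s n| ≤ 2 ^ s.length * ((n : ℝ) + 1) := by
  refine (abs_altMHN_le s hs n).trans ?_
  gcongr
  exact Real.sqrt_le_iff.2 ⟨by positivity, by nlinarith [n.cast_nonneg (α := ℝ)]⟩

theorem summable_altMHN_mul_pow (s : List ℤ) (hs : ∀ a ∈ s, a ≠ 0) {x : ℝ} (hx : |x| < 1) :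
    Summable fun n => altMHN s n * x ^ n :=
  summable_mul_pow_of_abs_le (abs_altMHN_le_linear s hs) hx

/-- Abel's limit theorem, applied to the increments of `ζ_n(s)`. -/
theorem HasAltMZV.tendsto_altMHNGenFun {s : List ℤ} (hs : ∀ a ∈ s, a ≠ 0) {z : ℝ}
    (h : HasAltMZV s z) : Tendsto (altMHNGenFun s) (𝓝[<] 1) (𝓝 z) := by
  let f : ℕ → ℝ := fun n => n.casesOn (altMHN s 0) fun n => altMHN s (n + 1) - altMHN s n
  have hf (n : ℕ) : ∑ i ∈ Finset.range (n + 1), f i = altMHN s n := by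
    induction n with
    | zero => simp [f]
    | succ n ih => rw [Finset.sum_range_succ, ih]; simp [f]
  have hlim : Tendsto (fun n => ∑ i ∈ Finset.range n, f i) atTop (𝓝 z) :=
    (tendsto_add_atTop_iff_nat 1).1 (by simpa only [hf, HasAltMZV] using h)
  refine (Real.tendsto_tsum_powerSeries_nhdsWithin_lt hlim).congr' ?_
  filter_upwards [Ioo_mem_nhdsLT (show (-1 : ℝ) < 1 by norm_num)] with x hx
  have hx' : |x| < 1 := abs_lt.2 hx
  have hsum := summable_altMHN_mul_pow s hs hx'
  have h1 : Summable fun n => f n * x ^ n := by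
    refine (summable_nat_add_iff 1).1 ?_
    have h2 := ((summable_nat_add_iff 1).2 hsum).sub (hsum.mul_left x)
    refine h2.congr fun n => ?_
    simp only [f]
    ring
  rw [altMHNGenFun, one_sub_mul_tsum_mul_pow hsum, h1.tsum_eq_zero_add]
  simp [f]

theorem altMHNGenFun_nil {x : ℝ} (hx : |x| < 1) : altMHNGenFun [] x = 1 := by
  have : 1 - x ≠ 0 := by linarith [(abs_lt.1 hx).2]
  simp [altMHNGenFun, altMHN, tsum_geometric_of_abs_lt_one hx, this]

theorem altMHNGenFun_cons_zero (a : ℤ) (t : List ℤ) : altMHNGenFun (a :: t) 0 = 0 := by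
  rw [altMHNGenFun, tsum_eq_single 0 (fun n hn => by simp [hn])]
  simp [altMHN_cons_zero]

/-- The coefficient of `x^(n+1)` is `a^(n+1) ζ_n(t) / (n+1)`; differentiation cancels the
denominator, and the powers of `a` rescale the argument. -/
theorem hasDerivAt_altMHNGenFun_cons {a : ℤ} (ha : a = 1 ∨ a = -1) (t : List ℤ)
    (ht : ∀ b ∈ t, b ≠ 0) {x : ℝ} (hx : |x| < 1) :
    HasDerivAt (altMHNGenFun (a :: t)) (a * altMHNGenFun t (a * x) / (1 - a * x)) x := by
  have ha0 : a ≠ 0 := by rcases ha with rfl | rfl <;> simp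
  have ha1 : |(a : ℝ)| = 1 := by rcases ha with rfl | rfl <;> simp
  have hax : |a * x| < 1 := by rwa [abs_mul, ha1, one_mul]
  have hterm (n : ℕ) : altMHN (a :: t) (n + 1) - altMHN (a :: t) n =
      (a : ℝ) ^ (n + 1) * altMHN t n / ((n : ℝ) + 1) := by
    rw [altMHN_cons_succ, add_sub_cancel_left]
    rcases ha with rfl | rfl <;> simp <;> ring
  have hd := hasDerivAt_tsum_div_mul_pow (c := fun n => (a : ℝ) ^ (n + 1) * altMHN t n)
    (fun n => by simpa [abs_mul, ha1] using abs_altMHN_le_linear t ht n) hx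
  have hne : 1 - a * x ≠ 0 := by linarith [(abs_lt.1 hax).2]
  have hval : a * altMHNGenFun t (a * x) / (1 - a * x) =
      ∑' n, (a : ℝ) ^ (n + 1) * altMHN t n * x ^ n := by
    rw [altMHNGenFun, mul_left_comm, mul_div_cancel_left₀ _ hne, ← tsum_mul_left]
    exact tsum_congr fun n => by rw [mul_pow]; ring
  rw [hval]
  refine hd.congr_of_eventuallyEq ?_
  filter_upwards [isOpen_Ioo.mem_nhds (abs_lt.1 hx)] with y hy
  rw [altMHNGenFun, one_sub_mul_tsum_mul_pow (summable_altMHN_mul_pow _ (by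
    simpa [ha0] using ht) (abs_lt.2 hy)), altMHN_cons_zero, zero_add]
  simp_rw [hterm]

theorem eq_of_hasDerivAt_of_eq_zero {f g f' : ℝ → ℝ}
    (hf : ∀ x, |x| < 1 → HasDerivAt f (f' x) x) (hg : ∀ x, |x| < 1 → HasDerivAt g (f' x) x)
    (h0 : f 0 = g 0) {x : ℝ} (hx : |x| < 1) : f x = g x := by
  refine isOpen_Ioo.eqOn_of_deriv_eq (s := Set.Ioo (-1 : ℝ) 1) (x := 0) isPreconnected_Ioo
    (fun y hy => (hf y (abs_lt.2 hy)).differentiableAt.differentiableWithinAt)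
    (fun y hy => (hg y (abs_lt.2 hy)).differentiableAt.differentiableWithinAt)
    (fun y hy => ?_) (by simp) h0 (abs_lt.1 hx)
  rw [(hf y (abs_lt.2 hy)).deriv, (hg y (abs_lt.2 hy)).deriv]

theorem altMHNGenFun_replicate_one (k : ℕ) {x : ℝ} (hx : |x| < 1) :
    altMHNGenFun (List.replicate k 1) x = (-Real.log (1 - x)) ^ k / k.factorial := by
  induction k generalizing x with
  | zero => simpa using altMHNGenFun_nil hx
  | succ k ih =>
    refine eq_of_hasDerivAt_of_eq_zero (f := altMHNGenFun (List.replicate (k + 1) 1))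
      (g := fun y => (-Real.log (1 - y)) ^ (k + 1) / (k + 1).factorial)
      (f' := fun y => (-Real.log (1 - y)) ^ k / k.factorial / (1 - y)) (fun y hy => ?_)
      (fun y hy => ?_) ?_ hx
    · have h := hasDerivAt_altMHNGenFun_cons (Or.inl rfl) (List.replicate k 1)
        (by simp +contextual [List.mem_replicate]) hy
      simp only [Int.cast_one, one_mul] at h
      rwa [ih hy] at h
    · have hy1 : 1 - y ≠ 0 := by linarith [(abs_lt.1 hy).2]
      refine HasDerivAt.congr_deriv ((((((hasDerivAt_id y).const_sub 1).log hy1).neg.pow (k + 1)).div_const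
        ((k + 1).factorial : ℝ))) ?_
      rw [Nat.factorial_succ]
      push_cast
      have : (k.factorial : ℝ) ≠ 0 := by positivity
      simp
      field_simp
    · rw [List.replicate_succ, altMHNGenFun_cons_zero]
      simp

theorem altMHNGenFun_neg_one_cons_replicate_one (k : ℕ) {x : ℝ} (hx : |x| < 1) :
    altMHNGenFun (-1 :: List.replicate k 1) x =
      (-Real.log (1 + x)) ^ (k + 1) / (k + 1).factorial := by
  refine eq_of_hasDerivAt_of_eq_zero (f := altMHNGenFun (-1 :: List.replicate k 1))
      (g := fun y => (-Real.log (1 + y)) ^ (k + 1) / (k + 1).factorial)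
      (f' := fun y => -((-Real.log (1 + y)) ^ k / k.factorial / (1 + y))) (fun y hy => ?_)
      (fun y hy => ?_) ?_ hx
  · have h := hasDerivAt_altMHNGenFun_cons (Or.inr rfl) (List.replicate k 1)
      (by simp +contextual [List.mem_replicate]) hy
    simp only [Int.cast_one, Int.cast_neg, neg_mul, one_mul, sub_neg_eq_add] at h
    rw [altMHNGenFun_replicate_one k (by rwa [abs_neg]), sub_neg_eq_add] at h
    rwa [← neg_div]
  · have hy1 : 1 + y ≠ 0 := by linarith [(abs_lt.1 hy).1]
    refine HasDerivAt.congr_deriv ((((((hasDerivAt_id y).const_add 1).log hy1).neg.pow (k + 1)).div_const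
      ((k + 1).factorial : ℝ))) ?_
    rw [Nat.factorial_succ]
    push_cast
    have : (k.factorial : ℝ) ≠ 0 := by positivity
    simp
    field_simp
  · rw [altMHNGenFun_cons_zero]
    simp

/-! ### Closure properties of the rational combinations -/

theorem mul_mem_rationalCombinations {x y : ℝ} (hx : x ∈ rationalCombinations)
    (hy : y ∈ rationalCombinations) : x * y ∈ rationalCombinations := by
  have h := Submodule.mul_mem_mul hx hy
  rw [rationalCombinations, Submodule.span_mul_span] at h
  refine Submodule.span_mono ?_ h
  rintro _ ⟨a, ha, b, hb, rfl⟩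
  exact Subsemigroup.mul_mem _ ha hb

theorem mem_rationalCombinations_of_mem {x : ℝ} (hx : x ∈ basicConstants) :
    x ∈ rationalCombinations :=
  Submodule.subset_span (Subsemigroup.subset_closure hx)

theorem ratCast_mul_mem_rationalCombinations (q : ℚ) {x : ℝ} (hx : x ∈ rationalCombinations) :
    (q : ℝ) * x ∈ rationalCombinations := by
  rw [← Rat.smul_def]
  exact Submodule.smul_mem _ q hx

theorem log_two_mem_rationalCombinations : Real.log 2 ∈ rationalCombinations :=
  mem_rationalCombinations_of_mem (Or.inr rfl)

theorem pow_mul_mem_rationalCombinations {x y : ℝ} (hx : x ∈ rationalCombinations)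
    (hy : y ∈ rationalCombinations) (n : ℕ) : x ^ n * y ∈ rationalCombinations := by
  induction n with
  | zero => simpa using hy
  | succ n ih => rw [pow_succ', mul_assoc]; exact mul_mem_rationalCombinations hx ih

theorem polylog_half_mem_rationalCombinations (p : ℕ) :
    polylog (p + 1) (1 / 2) ∈ rationalCombinations :=
  mem_rationalCombinations_of_mem (Or.inl (Or.inr ⟨p + 1, by omega, rfl⟩))

theorem polylog_one_mem_rationalCombinations (p : ℕ) :
    polylog (p + 2) 1 ∈ rationalCombinations := by
  refine mem_rationalCombinations_of_mem (Or.inl (Or.inl ⟨p + 2, by omega, ?_⟩))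
  rw [zeta_nat_eq_tsum_of_gt_one (by omega), polylog]
  have h : Summable fun n : ℕ => 1 / (n : ℂ) ^ (p + 2) := by
    have := (Complex.summable_one_div_nat_cpow (p := ((p + 2 : ℕ) : ℂ))).2 (by simp; linarith)
    simpa only [Complex.cpow_natCast] using this
  rw [h.tsum_eq_zero_add]
  push_cast
  simp

/-! ### Polylogarithms and integrals of powers of the logarithm -/

theorem hasDerivAt_polylog_succ (p : ℕ) {y : ℝ} (hy : y ∈ Set.Ioo (0 : ℝ) 1) :
    HasDerivAt (polylog (p + 1)) (polylog p y / y) y := by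
  have hc (n : ℕ) : |1 / ((n : ℝ) + 1) ^ p| ≤ 1 * ((n : ℝ) + 1) := by
    have h1 : (1 : ℝ) ≤ n + 1 := by linarith [n.cast_nonneg (α := ℝ)]
    rw [abs_of_pos (by positivity), one_mul]
    exact (div_le_one_of_le₀ (one_le_pow₀ h1) (by positivity)).trans h1
  have h := hasDerivAt_tsum_div_mul_pow hc (abs_lt.2 ⟨by linarith [hy.1], hy.2⟩)
  have hf : polylog (p + 1) = fun x => ∑' n : ℕ, 1 / ((n : ℝ) + 1) ^ p / ((n : ℝ) + 1) *
      x ^ (n + 1) := by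
    funext x
    exact tsum_congr fun n => by rw [pow_succ ((n : ℝ) + 1), div_div, one_div_mul_eq_div]
  rw [hf]
  refine h.congr_deriv ?_
  rw [polylog, ← tsum_div_const]
  refine tsum_congr fun n => ?_
  have := hy.1.ne'
  field_simp
  ring

theorem polylog_zero_div {y : ℝ} (hy : y ∈ Set.Ioo (0 : ℝ) 1) : polylog 0 y / y = 1 / (1 - y) := by
  have h : polylog 0 y = y * (1 - y)⁻¹ := by
    rw [← tsum_geometric_of_lt_one hy.1.le hy.2, ← tsum_mul_left]
    simp [polylog, pow_succ']
  have := hy.1.ne'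
  rw [h]
  field_simp

theorem polylog_one_eq_neg_log {y : ℝ} (hy : y ∈ Set.Ioo (0 : ℝ) 1) :
    polylog 1 y = -Real.log (1 - y) := by
  rw [← (Real.hasSum_pow_div_log_of_abs_lt_one (abs_lt.2 ⟨by linarith [hy.1], hy.2⟩)).tsum_eq]
  simp [polylog]

theorem tendsto_polylog_one (p : ℕ) :
    Tendsto (polylog (p + 2)) (𝓝[<] 1) (𝓝 (polylog (p + 2) 1)) := by
  have hs : Summable fun n : ℕ => 1 / ((n : ℝ) + 1) ^ (p + 2) := by
    have := (summable_nat_add_iff 1).2 (Real.summable_one_div_nat_pow.2 (show 1 < p + 2 by omega))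
    simpa using this
  have hc : ContinuousOn (polylog (p + 2)) (Set.Icc 0 1) := by
    refine continuousOn_tsum (fun n => by fun_prop) hs fun n x hx => ?_
    rw [Real.norm_eq_abs, abs_of_nonneg (div_nonneg (pow_nonneg hx.1 _) (by positivity))]
    gcongr
    exact pow_le_one₀ hx.1 hx.2
  exact (hc 1 (by simp)).mono_left (nhdsWithin_le_of_mem (mem_of_superset
    (Ioo_mem_nhdsLT (show (0 : ℝ) < 1 by norm_num)) Set.Ioo_subset_Icc_self))

theorem tendsto_log_nhdsLT_one : Tendsto Real.log (𝓝[<] 1) (𝓝 0) := by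
  have h := (Real.continuousAt_log one_ne_zero).tendsto
  rw [Real.log_one] at h
  exact h.mono_left nhdsWithin_le_nhds

/-- For `y > 1/2` one has `|log y| ≤ 2(1-y)`, and `u log u → 0` as `u → 0`. -/
theorem tendsto_log_mul_log_one_sub :
    Tendsto (fun y => Real.log y * Real.log (1 - y)) (𝓝[<] 1) (𝓝 0) := by
  have h1 : Tendsto (fun y : ℝ => 2 * |(1 - y) * Real.log (1 - y)|) (𝓝[<] 1) (𝓝 0) := by
    have h2 : Continuous fun y : ℝ => 2 * |(1 - y) * Real.log (1 - y)| :=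
      continuous_const.mul
        (Real.continuous_mul_log.comp (continuous_const.sub continuous_id)).abs
    have h3 := h2.tendsto 1
    simp only [sub_self, zero_mul, abs_zero, mul_zero] at h3
    exact h3.mono_left nhdsWithin_le_nhds
  refine squeeze_zero_norm' ?_ h1
  filter_upwards [Ioo_mem_nhdsLT (show (1 / 2 : ℝ) < 1 by norm_num)] with y hy
  have hy0 : 0 < y := by linarith [hy.1]
  rw [Real.norm_eq_abs, abs_mul, abs_mul, ← mul_assoc]
  refine mul_le_mul_of_nonneg_right ?_ (abs_nonneg _)
  rw [abs_of_nonpos (Real.log_nonpos hy0.le hy.2.le), abs_of_pos (by linarith [hy.2])]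
  have h4 := Real.one_sub_inv_le_log_of_pos hy0
  have h5 : y⁻¹ ≤ 2 := by rw [inv_le_comm₀ hy0 two_pos]; linarith [hy.1]
  have h6 : y⁻¹ - 1 = y⁻¹ * (1 - y) := by rw [mul_sub, inv_mul_cancel₀ hy0.ne']; ring
  nlinarith [hy.2]

/-- An antiderivative of `logᵖ(y) Li_q(y) / y`. -/
noncomputable def logPolylogPrimitive : ℕ → ℕ → ℝ → ℝ
  | 0, q, y => polylog (q + 1) y
  | p + 1, q, y =>
      Real.log y ^ (p + 1) * polylog (q + 1) y - (p + 1) * logPolylogPrimitive p (q + 1) y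

/-- Integration by parts: the recursive term cancels the derivative of the power of `log y`. -/
theorem hasDerivAt_logPolylogPrimitive (p q : ℕ) {y : ℝ} (hy : y ∈ Set.Ioo (0 : ℝ) 1) :
    HasDerivAt (logPolylogPrimitive p q) (Real.log y ^ p * (polylog q y / y)) y := by
  induction p generalizing q with
  | zero => exact (hasDerivAt_polylog_succ q hy).congr_deriv (by simp)
  | succ p ih =>
    refine HasDerivAt.congr_deriv (((((Real.hasDerivAt_log hy.1.ne').pow (p + 1)).mul
      (hasDerivAt_polylog_succ q hy)).sub ((ih (q + 1)).const_mul ((p : ℝ) + 1)))) ?_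
    push_cast
    simp
    ring

theorem logPolylogPrimitive_half_mem (p q : ℕ) :
    logPolylogPrimitive p q (1 / 2) ∈ rationalCombinations := by
  induction p generalizing q with
  | zero => exact polylog_half_mem_rationalCombinations q
  | succ p ih =>
    refine Submodule.sub_mem _ (pow_mul_mem_rationalCombinations ?_
      (polylog_half_mem_rationalCombinations q) _) ?_
    · rw [one_div, Real.log_inv]
      exact Submodule.neg_mem _ log_two_mem_rationalCombinations
    · simpa using ratCast_mul_mem_rationalCombinations (p + 1) (ih (q + 1))

/-- The boundary terms vanish at 1, as `log y` outweighs even the singularity of `Li₁`. What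
survives is an integer multiple of `ζ(p+q+1)`; the excluded case `p = q = 0` is `Li₁`, which
diverges. -/
theorem exists_tendsto_logPolylogPrimitive (p q : ℕ) (hpq : 1 ≤ p + q) :
    ∃ z ∈ rationalCombinations, Tendsto (logPolylogPrimitive p q) (𝓝[<] 1) (𝓝 z) := by
  induction p generalizing q with
  | zero =>
    obtain ⟨q, rfl⟩ : ∃ r, q = r + 1 := ⟨q - 1, by omega⟩
    exact ⟨_, polylog_one_mem_rationalCombinations q, tendsto_polylog_one q⟩
  | succ p ih =>
    obtain ⟨z, hz, h⟩ := ih (q + 1) (by omega)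
    have h0 : Tendsto (fun y => Real.log y ^ (p + 1) * polylog (q + 1) y) (𝓝[<] 1) (𝓝 0) := by
      have h1 : Tendsto (fun y => Real.log y * polylog (q + 1) y) (𝓝[<] 1) (𝓝 0) := by
        cases q with
        | zero =>
          have h2 := tendsto_log_mul_log_one_sub.neg
          rw [neg_zero] at h2
          refine h2.congr' ?_
          filter_upwards [Ioo_mem_nhdsLT (show (0 : ℝ) < 1 by norm_num)] with y hy
          rw [zero_add, polylog_one_eq_neg_log hy, mul_neg]
        | succ q => simpa using tendsto_log_nhdsLT_one.mul (tendsto_polylog_one q)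
      have h2 := (tendsto_log_nhdsLT_one.pow p).mul h1
      rw [mul_zero] at h2
      exact h2.congr fun y => by ring
    refine ⟨0 - (p + 1) * z, Submodule.sub_mem _ (Submodule.zero_mem _) ?_,
      h0.sub (h.const_mul _)⟩
    simpa using ratCast_mul_mem_rationalCombinations (p + 1) hz

/-! ### Iterated integrals in closed form -/

/-- For `w(t) = log((1 + t) / 2)`, the integral of
`(w(x) - w(t)) ^ m / m! * w(t) ^ p / (1 - t)` over `0 ≤ t ≤ x`. -/
noncomputable def halfLogIntegral : ℕ → ℕ → ℝ → ℝ
  | 0, p, x => logPolylogPrimitive p 0 ((1 + x) / 2) - logPolylogPrimitive p 0 (1 / 2)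
  | m + 1, p, x =>
      (Real.log ((1 + x) / 2) * halfLogIntegral m p x - halfLogIntegral m (p + 1) x) / (m + 1)

theorem halfLogIntegral_zero_right (m p : ℕ) : halfLogIntegral m p 0 = 0 := by
  induction m generalizing p with
  | zero => simp [halfLogIntegral]
  | succ m ih => simp [halfLogIntegral, ih]

theorem half_one_add_mem_Ioo {x : ℝ} (hx : |x| < 1) : (1 + x) / 2 ∈ Set.Ioo (0 : ℝ) 1 :=
  ⟨by linarith [(abs_lt.1 hx).1], by linarith [(abs_lt.1 hx).2]⟩

theorem hasDerivAt_halfLogIntegral_zero (p : ℕ) {x : ℝ} (hx : |x| < 1) :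
    HasDerivAt (halfLogIntegral 0 p) (Real.log ((1 + x) / 2) ^ p / (1 - x)) x := by
  have hy := half_one_add_mem_Ioo hx
  have h := hasDerivAt_logPolylogPrimitive p 0 hy
  rw [polylog_zero_div hy] at h
  refine HasDerivAt.congr_deriv ((h.comp x (((hasDerivAt_id x).const_add 1).div_const 2)).sub_const
    (logPolylogPrimitive p 0 (1 / 2))) ?_
  have h1 : 1 - x ≠ 0 := by linarith [(abs_lt.1 hx).2]
  have h2 : 1 - (1 + x) / 2 ≠ 0 := by linarith [hy.2]
  have h3 : 1 - (1 + x) / 2 = (1 - x) / 2 := by ring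
  rw [h3]
  field_simp

theorem hasDerivAt_log_half_one_add {x : ℝ} (hx : |x| < 1) :
    HasDerivAt (fun y => Real.log ((1 + y) / 2)) (1 / (1 + x)) x := by
  have hy := half_one_add_mem_Ioo hx
  have h1 : 1 + x ≠ 0 := by linarith [(abs_lt.1 hx).1]
  refine HasDerivAt.congr_deriv ((((hasDerivAt_id x).const_add 1).div_const 2).log hy.1.ne') ?_
  simp
  field_simp

/-- The kernel vanishes at `t = x`, so only `w(x)` contributes, with `w'(x) = 1/(1+x)`. The proof
reads this off the recursion in `m`. -/
theorem hasDerivAt_halfLogIntegral_succ (m p : ℕ) {x : ℝ} (hx : |x| < 1) :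
    HasDerivAt (halfLogIntegral (m + 1) p) (halfLogIntegral m p x / (1 + x)) x := by
  have h1 : 1 + x ≠ 0 := by linarith [(abs_lt.1 hx).1]
  have hw := hasDerivAt_log_half_one_add hx
  induction m generalizing p with
  | zero =>
    refine HasDerivAt.congr_deriv ((((hw.mul (hasDerivAt_halfLogIntegral_zero p hx)).sub
      (hasDerivAt_halfLogIntegral_zero (p + 1) hx)).div_const (((0 : ℕ) : ℝ) + 1))) ?_
    simp
    ring
  | succ m ih =>
    refine HasDerivAt.congr_deriv ((((hw.mul (ih p)).sub (ih (p + 1))).div_const (((m + 1 : ℕ) : ℝ) + 1))) ?_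
    have h2 : (m : ℝ) + 1 ≠ 0 := by positivity
    have h3 : (m : ℝ) + 1 + 1 ≠ 0 := by positivity
    have h4 : Real.log ((1 + x) / 2) * halfLogIntegral m p x - halfLogIntegral m (p + 1) x =
        (m + 1) * halfLogIntegral (m + 1) p x := by
      rw [halfLogIntegral]
      field_simp
    push_cast
    rw [div_eq_iff h3]
    field_simp
    linear_combination h4

theorem tendsto_half_one_add_nhdsLT_one :
    Tendsto (fun x : ℝ => (1 + x) / 2) (𝓝[<] 1) (𝓝[<] 1) := by
  refine tendsto_nhdsWithin_iff.2 ⟨?_, ?_⟩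
  · have h : Continuous fun x : ℝ => (1 + x) / 2 := by fun_prop
    have h1 := h.tendsto 1
    norm_num at h1
    exact h1.mono_left nhdsWithin_le_nhds
  · filter_upwards [self_mem_nhdsWithin] with x hx
    have : x < 1 := hx
    show (1 + x) / 2 < 1
    linarith

theorem tendsto_log_mul_halfLogIntegral_zero_zero :
    Tendsto (fun x => Real.log ((1 + x) / 2) * halfLogIntegral 0 0 x) (𝓝[<] 1) (𝓝 0) := by
  have h1 := tendsto_log_mul_log_one_sub.neg.sub
    (tendsto_log_nhdsLT_one.mul_const (logPolylogPrimitive 0 0 (1 / 2)))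
  simp only [neg_zero, zero_mul, sub_zero] at h1
  refine (h1.comp tendsto_half_one_add_nhdsLT_one).congr' ?_
  filter_upwards [Ioo_mem_nhdsLT (show (-1 : ℝ) < 1 by norm_num)] with x hx
  have hy := half_one_add_mem_Ioo (abs_lt.2 hx)
  simp only [Function.comp, halfLogIntegral, mul_sub]
  rw [← mul_neg, ← polylog_one_eq_neg_log hy]
  rfl

/-- Because `w(1) = 0`, the term multiplied by `w(x)` drops out in the limit and the recursion
trades `m` for `p`. The divergent case `m = p = 0` enters only multiplied by `w(x)`, which kills its
logarithmic growth. -/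
theorem exists_tendsto_halfLogIntegral (m p : ℕ) (hmp : 1 ≤ m + p) :
    ∃ z ∈ rationalCombinations, Tendsto (halfLogIntegral m p) (𝓝[<] 1) (𝓝 z) := by
  induction m generalizing p with
  | zero =>
    obtain ⟨z, hz, h⟩ := exists_tendsto_logPolylogPrimitive p 0 (by omega)
    exact ⟨_, Submodule.sub_mem _ hz (logPolylogPrimitive_half_mem p 0),
      (h.comp tendsto_half_one_add_nhdsLT_one).sub_const _⟩
  | succ m ih =>
    obtain ⟨z, hz, h⟩ := ih (p + 1) (by omega)
    have h0 : Tendsto (fun x => Real.log ((1 + x) / 2) * halfLogIntegral m p x) (𝓝[<] 1)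
        (𝓝 0) := by
      by_cases hmp' : 1 ≤ m + p
      · obtain ⟨z', -, h'⟩ := ih p hmp'
        simpa using (tendsto_log_nhdsLT_one.comp tendsto_half_one_add_nhdsLT_one).mul h'
      · obtain ⟨rfl, rfl⟩ : m = 0 ∧ p = 0 := by omega
        exact tendsto_log_mul_halfLogIntegral_zero_zero
    refine ⟨(0 - z) / (m + 1), ?_, (h0.sub h).div_const _⟩
    rw [div_eq_inv_mul]
    simpa using ratCast_mul_mem_rationalCombinations ((m + 1 : ℚ)⁻¹)
      (Submodule.sub_mem _ (Submodule.zero_mem _) hz)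

/-- For `w(t) = log((1 + t) / 2)`, the integral of
`(w(x) - w(t)) ^ m / m! * (-log(1 + t)) ^ k / k! / (1 - t)` over `0 ≤ t ≤ x`. -/
noncomputable def logIntegral (m k : ℕ) (x : ℝ) : ℝ :=
  (-1) ^ k / k.factorial *
    ∑ i ∈ Finset.range (k + 1), Real.log 2 ^ (k - i) * k.choose i * halfLogIntegral m i x

theorem logIntegral_zero_right (m k : ℕ) : logIntegral m k 0 = 0 := by
  simp [logIntegral, halfLogIntegral_zero_right]

theorem hasDerivAt_logIntegral_zero (k : ℕ) {x : ℝ} (hx : |x| < 1) :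
    HasDerivAt (logIntegral 0 k) ((-Real.log (1 + x)) ^ k / k.factorial / (1 - x)) x := by
  have h := (HasDerivAt.fun_sum fun i (_ : i ∈ Finset.range (k + 1)) =>
    (hasDerivAt_halfLogIntegral_zero i hx).const_mul (Real.log 2 ^ (k - i) * k.choose i)).const_mul
      ((-1 : ℝ) ^ k / k.factorial)
  refine h.congr_deriv ?_
  have hy := half_one_add_mem_Ioo hx
  -- The sum in `logIntegral` is the binomial expansion of this identity's `k`-th power.
  have hlog : Real.log (1 + x) = Real.log ((1 + x) / 2) + Real.log 2 := by
    rw [← Real.log_mul hy.1.ne' two_ne_zero, div_mul_cancel₀ _ two_ne_zero]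
  rw [hlog, neg_pow (_ + _), add_pow, mul_div_right_comm, mul_div_assoc, Finset.sum_div]
  congr 1
  exact Finset.sum_congr rfl fun i _ => by ring

theorem hasDerivAt_logIntegral_succ (m k : ℕ) {x : ℝ} (hx : |x| < 1) :
    HasDerivAt (logIntegral (m + 1) k) (logIntegral m k x / (1 + x)) x := by
  have h := (HasDerivAt.fun_sum fun i (_ : i ∈ Finset.range (k + 1)) =>
    (hasDerivAt_halfLogIntegral_succ m i hx).const_mul
      (Real.log 2 ^ (k - i) * k.choose i)).const_mul ((-1 : ℝ) ^ k / k.factorial)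
  refine h.congr_deriv ?_
  rw [logIntegral, mul_div_assoc, Finset.sum_div]
  congr 1
  exact Finset.sum_congr rfl fun i _ => by ring

theorem exists_tendsto_logIntegral (m k : ℕ) (hm : 1 ≤ m) :
    ∃ z ∈ rationalCombinations, Tendsto (logIntegral m k) (𝓝[<] 1) (𝓝 z) := by
  choose z hz h using fun i => exists_tendsto_halfLogIntegral m i (by omega)
  refine ⟨_, ?_, (tendsto_finsetSum (Finset.range (k + 1)) fun i _ =>
    (h i).const_mul (Real.log 2 ^ (k - i) * k.choose i)).const_mul ((-1 : ℝ) ^ k / k.factorial)⟩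
  have hsum : ∑ i ∈ Finset.range (k + 1), Real.log 2 ^ (k - i) * k.choose i * z i ∈
      rationalCombinations := by
    refine Submodule.sum_mem _ fun i _ => ?_
    rw [mul_assoc]
    refine pow_mul_mem_rationalCombinations log_two_mem_rationalCombinations ?_ _
    simpa using ratCast_mul_mem_rationalCombinations (k.choose i) (hz i)
  simpa using ratCast_mul_mem_rationalCombinations ((-1) ^ k / k.factorial) hsum

/-! ### Identification of the generating function and conclusion -/

/-- The argument is `-x` because the outermost bar will evaluate this tail there. The reflection
turns each `dt/(1-t)` from an entry `1` into `-dt/(1+t)`, whence the sign. -/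
theorem altMHNGenFun_replicate_append_neg (m k : ℕ) {x : ℝ} (hx : |x| < 1) :
    altMHNGenFun (List.replicate m 1 ++ -1 :: -1 :: List.replicate k 1) (-x) =
      (-1) ^ m * logIntegral m (k + 1) x := by
  induction m generalizing x with
  | zero =>
    rw [pow_zero, one_mul]
    refine eq_of_hasDerivAt_of_eq_zero
      (f := fun y => altMHNGenFun (-1 :: -1 :: List.replicate k 1) (-y))
      (g := logIntegral 0 (k + 1)) (fun y hy => ?_)
      (fun y hy => hasDerivAt_logIntegral_zero (k + 1) hy) ?_ hx
    · have h := (hasDerivAt_altMHNGenFun_cons (Or.inr rfl) (-1 :: List.replicate k 1)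
        (by simp +contextual [List.mem_replicate]) (by rwa [abs_neg])).comp y (hasDerivAt_neg y)
      refine h.congr_deriv ?_
      simp [altMHNGenFun_neg_one_cons_replicate_one k hy, neg_div]
    · rw [neg_zero, altMHNGenFun_cons_zero, logIntegral_zero_right]
  | succ m ih =>
    refine eq_of_hasDerivAt_of_eq_zero
      (f := fun y => altMHNGenFun
        (1 :: (List.replicate m 1 ++ -1 :: -1 :: List.replicate k 1)) (-y))
      (g := fun y => (-1) ^ (m + 1) * logIntegral (m + 1) (k + 1) y) (fun y hy => ?_)
      (fun y hy => (hasDerivAt_logIntegral_succ m (k + 1) hy).const_mul _) ?_ hx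
    · have h := (hasDerivAt_altMHNGenFun_cons (Or.inl rfl)
        (List.replicate m 1 ++ -1 :: -1 :: List.replicate k 1)
        (by simp +contextual [List.mem_replicate, or_imp]) (by rwa [abs_neg])).comp y
          (hasDerivAt_neg y)
      refine h.congr_deriv ?_
      simp only [Int.cast_one, one_mul, ih hy]
      ring
    · rw [neg_zero, altMHNGenFun_cons_zero, logIntegral_zero_right, mul_zero]

theorem altMHNGenFun_neg_one_cons_replicate_append (m k : ℕ) {x : ℝ} (hx : |x| < 1) :
    altMHNGenFun (-1 :: (List.replicate m 1 ++ -1 :: -1 :: List.replicate k 1)) x =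
      (-1) ^ (m + 1) * logIntegral (m + 1) (k + 1) x := by
  refine eq_of_hasDerivAt_of_eq_zero
    (f := altMHNGenFun (-1 :: (List.replicate m 1 ++ -1 :: -1 :: List.replicate k 1)))
    (g := fun y => (-1) ^ (m + 1) * logIntegral (m + 1) (k + 1) y) (fun y hy => ?_)
    (fun y hy => (hasDerivAt_logIntegral_succ m (k + 1) hy).const_mul _) ?_ hx
  · refine HasDerivAt.congr_deriv (hasDerivAt_altMHNGenFun_cons (Or.inr rfl)
      (List.replicate m 1 ++ -1 :: -1 :: List.replicate k 1)
      (by simp +contextual [List.mem_replicate, or_imp]) hy) ?_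
    simp only [Int.cast_neg, Int.cast_one, neg_mul, one_mul, sub_neg_eq_add,
      altMHNGenFun_replicate_append_neg m k hy]
    ring
  · rw [altMHNGenFun_cons_zero, logIntegral_zero_right, mul_zero]

theorem theorem6p3 (m k : ℕ) (hm : 1 ≤ m) (hk : 1 ≤ k) :
    ∃ z : ℝ,
      HasAltMZV ([-1] ++ List.replicate (m - 1) 1 ++ [-1, -1] ++ List.replicate (k - 1) 1) z ∧
        z ∈ rationalCombinations := by
  obtain ⟨m, rfl⟩ : ∃ n, m = n + 1 := ⟨m - 1, by omega⟩
  obtain ⟨k, rfl⟩ : ∃ n, k = n + 1 := ⟨k - 1, by omega⟩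
  have hlist : [-1] ++ List.replicate (m + 1 - 1) 1 ++ [-1, -1] ++ List.replicate (k + 1 - 1) 1 =
      (-1 : ℤ) :: (List.replicate m 1 ++ -1 :: -1 :: List.replicate k 1) := by simp
  have hne : ∀ a ∈ List.replicate m (1 : ℤ) ++ -1 :: -1 :: List.replicate k 1, a ≠ 0 := by
    simp +contextual [List.mem_replicate, or_imp]
  rw [hlist]
  obtain ⟨z, hz⟩ := exists_hasAltMZV_neg_one_cons _ hne
  refine ⟨z, hz, ?_⟩
  -- The outermost bar supplies one integration against `dt/(1+t)`, so the first index is positive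
  -- and the limit is finite.
  obtain ⟨z', hz', h⟩ := exists_tendsto_logIntegral (m + 1) (k + 1) (by omega)
  have hlim := hz.tendsto_altMHNGenFun (by simpa using hne)
  have heq : z = (-1) ^ (m + 1) * z' := by
    refine tendsto_nhds_unique hlim ((h.const_mul ((-1) ^ (m + 1))).congr' ?_)
    filter_upwards [Ioo_mem_nhdsLT (show (-1 : ℝ) < 1 by norm_num)] with x hx
    exact (altMHNGenFun_neg_one_cons_replicate_append m k (abs_lt.2 hx)).symm
  rw [heq]
  simpa using ratCast_mul_mem_rationalCombinations ((-1) ^ (m + 1)) hz'
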